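/- For $1\le p<\infty$ let $\mathcal F_p$ be the Fock space of all entire functions $f:\mathbb C\to\mathbb C$ with $$\|f\|_p^p=\frac{p}{2\pi}\int_{\mathbb C}|f(z)|^p e^{-p|z|^2/2}\,dA(z)<\infty,$$ where $dA$ is Lebesgue area measure, equipped with the norm $\|\cdot\|_p$. A bounded linear operator $T$ on a complex normed space $X$ is called supercyclic if there is a vector $x\in X$ whose projective orbit $\{c\,T^n x : c\in\mathbb C,\ n\in\mathbb N_0\}$ is dense in $X$. Let $1\le p<\infty$. (i) If $\psi$ is an entire function such that the composition operator $C_\psi f=f\circ\psi$ is a bounded operator from $\mathcal F_p$ into $\mathcal F_p$, then $C_\psi$ is not supercyclic on $\mathcal F_p$. (ii) If $u$ is an entire function such that the multiplication operator $M_u f=u\cdot f$ is a bounded operator from $\mathcal F_p$ into $\mathcal F_p$, then $M_u$ is not supercyclic on $\mathcal F_p$. -/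

import Mathlib

open MeasureTheory

noncomputable section

namespace Fock

/-- The integrand `|f z| ^ p * exp (-p |z|² / 2)` of the Fock norm. -/
def integrand (p : ℝ) (f : ℂ → ℂ) (z : ℂ) : ℝ :=
  ‖f z‖ ^ p * Real.exp (-(p * ‖z‖ ^ 2 / 2))

/-- `f z * exp (-|z|² / 2)`, an auxiliary function used to transfer facts about `L^p`. -/
def weighted (f : ℂ → ℂ) (z : ℂ) : ℂ :=
  f z * (Real.exp (-(‖z‖ ^ 2 / 2)) : ℂ)

lemma norm_weighted_rpow (p : ℝ) (f : ℂ → ℂ) (z : ℂ) :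
    ‖weighted f z‖ ^ p = integrand p f z := by
  unfold weighted integrand
  rw [norm_mul, Complex.norm_real, Real.norm_of_nonneg (Real.exp_pos _).le,
    Real.mul_rpow (norm_nonneg _) (Real.exp_pos _).le, ← Real.exp_mul]
  congr 2
  ring

lemma continuous_weighted {f : ℂ → ℂ} (hf : Differentiable ℂ f) : Continuous (weighted f) := by
  have := hf.continuous
  unfold weighted
  fun_prop

lemma memLp_weighted_iff {p : ℝ} (hp : 1 ≤ p) {f : ℂ → ℂ} (hf : Differentiable ℂ f) :
    MemLp (weighted f) (ENNReal.ofReal p) volume ↔ Integrable (integrand p f) volume := by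
  have h0 : ENNReal.ofReal p ≠ 0 := by
    simpa using lt_of_lt_of_le one_pos hp
  rw [← integrable_norm_rpow_iff (continuous_weighted hf).aestronglyMeasurable h0
    ENNReal.ofReal_ne_top, ENNReal.toReal_ofReal (by linarith)]
  simp only [norm_weighted_rpow]

/-- The underlying vector space of the Fock space: the entire functions `f` for which
`|f z| ^ p * exp (-p |z|² / 2)` is integrable for the Lebesgue area measure on `ℂ`. -/
def submodule (p : ℝ) [hp : Fact (1 ≤ p)] : Submodule ℂ (ℂ → ℂ) where
  carrier := {f | Differentiable ℂ f ∧ Integrable (integrand p f) volume}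
  zero_mem' := by
    refine ⟨differentiable_const 0, ?_⟩
    refine (memLp_weighted_iff hp.out (f := 0) (differentiable_const 0)).1 ?_
    have : weighted (0 : ℂ → ℂ) = 0 := by ext z; simp [weighted]
    rw [this]
    exact MemLp.zero
  add_mem' := by
    rintro f g ⟨hf, hf'⟩ ⟨hg, hg'⟩
    refine ⟨hf.add hg, ?_⟩
    rw [← memLp_weighted_iff hp.out hf] at hf'
    rw [← memLp_weighted_iff hp.out hg] at hg'
    rw [← memLp_weighted_iff hp.out (hf.add hg)]
    have : weighted (f + g) = weighted f + weighted g := by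
      ext z; simp [weighted, add_mul]
    rw [this]
    exact hf'.add hg'
  smul_mem' := by
    rintro c f ⟨hf, hf'⟩
    refine ⟨hf.const_smul c, ?_⟩
    rw [← memLp_weighted_iff hp.out hf] at hf'
    rw [← memLp_weighted_iff hp.out (hf.const_smul c)]
    have : weighted (c • f) = c • weighted f := by
      ext z; simp [weighted, mul_assoc]
    rw [this]
    exact hf'.const_smul c

end Fock

/-- The Fock space `F_p`, `1 ≤ p < ∞`. It is a type of its own, so that it carries the topology
of the Fock norm and not the topology of pointwise convergence. -/
def FockSpace (p : ℝ) [Fact (1 ≤ p)] : Type := Fock.submodule p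

namespace FockSpace

variable {p : ℝ} [hp : Fact (1 ≤ p)]

instance : AddCommGroup (FockSpace p) := inferInstanceAs (AddCommGroup (Fock.submodule p))

instance : Module ℂ (FockSpace p) := inferInstanceAs (Module ℂ (Fock.submodule p))

/-- The entire function underlying an element of the Fock space. -/
def toFun (f : FockSpace p) : ℂ → ℂ := Subtype.val f

instance : CoeFun (FockSpace p) (fun _ => ℂ → ℂ) := ⟨toFun⟩

lemma differentiable (f : FockSpace p) : Differentiable ℂ f := f.2.1

lemma integrable (f : FockSpace p) : Integrable (Fock.integrand p f) volume := f.2.2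

@[ext] lemma ext {f g : FockSpace p} (h : ∀ z, f z = g z) : f = g := Subtype.ext (funext h)

@[simp] lemma add_apply (f g : FockSpace p) (z : ℂ) : (f + g) z = f z + g z := rfl

@[simp] lemma smul_apply (c : ℂ) (f : FockSpace p) (z : ℂ) : (c • f) z = c * f z := rfl

@[simp] lemma zero_apply (z : ℂ) : (0 : FockSpace p) z = 0 := rfl

/-- The Fock norm `((p / 2π) ∫ |f z| ^ p exp (-p |z|² / 2) dA(z)) ^ (1 / p)`. -/
instance : Norm (FockSpace p) :=
  ⟨fun f => (p / (2 * Real.pi) * ∫ z : ℂ, ‖f z‖ ^ p * Real.exp (-(p * ‖z‖ ^ 2 / 2))) ^ (1 / p)⟩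

lemma norm_def (f : FockSpace p) :
    ‖f‖ = (p / (2 * Real.pi) * ∫ z : ℂ, ‖f z‖ ^ p * Real.exp (-(p * ‖z‖ ^ 2 / 2))) ^ (1 / p) :=
  rfl

lemma memLp (f : FockSpace p) : MemLp (Fock.weighted f) (ENNReal.ofReal p) volume :=
  (Fock.memLp_weighted_iff hp.out f.differentiable).2 f.integrable

lemma norm_eq (f : FockSpace p) :
    ‖f‖ = (p / (2 * Real.pi)) ^ (1 / p) *
      (eLpNorm (Fock.weighted f) (ENNReal.ofReal p) volume).toReal := by
  have h1 : 1 ≤ p := hp.out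
  have h0 : ENNReal.ofReal p ≠ 0 := by
    simpa using lt_of_lt_of_le one_pos h1
  have hn : 0 ≤ ∫ z : ℂ, ‖f z‖ ^ p * Real.exp (-(p * ‖z‖ ^ 2 / 2)) :=
    integral_nonneg fun z => by positivity
  rw [f.memLp.eLpNorm_eq_integral_rpow_norm h0 ENNReal.ofReal_ne_top,
    ENNReal.toReal_ofReal (show (0 : ℝ) ≤ p by linarith)]
  simp only [Fock.norm_weighted_rpow, Fock.integrand]
  rw [ENNReal.toReal_ofReal (by positivity), norm_def,
    Real.mul_rpow (by positivity) hn, one_div]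

lemma normCore : NormedSpace.Core ℂ (FockSpace p) where
  norm_nonneg f := by
    have h1 : 1 ≤ p := hp.out
    rw [norm_eq]
    positivity
  norm_smul c f := by
    have : Fock.weighted (c • f : FockSpace p) = c • Fock.weighted f := by
      ext z; simp [Fock.weighted, mul_assoc]
    rw [norm_eq, norm_eq, this, eLpNorm_const_smul, ENNReal.toReal_mul, toReal_enorm]
    ring
  norm_triangle f g := by
    have h1 : 1 ≤ p := hp.out
    have : Fock.weighted (f + g : FockSpace p) = Fock.weighted f + Fock.weighted g := by
      ext z; simp [Fock.weighted, add_mul]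
    rw [norm_eq, norm_eq, norm_eq, this, ← mul_add,
      ← ENNReal.toReal_add f.memLp.eLpNorm_ne_top g.memLp.eLpNorm_ne_top]
    gcongr
    · exact ENNReal.add_ne_top.2 ⟨f.memLp.eLpNorm_ne_top, g.memLp.eLpNorm_ne_top⟩
    · exact eLpNorm_add_le f.memLp.1 g.memLp.1 (by simpa using h1)
  norm_eq_zero_iff f := by
    have h1 : 1 ≤ p := hp.out
    have h0 : ENNReal.ofReal p ≠ 0 := by
      simpa using lt_of_lt_of_le one_pos h1
    have hc : (p / (2 * Real.pi)) ^ (1 / p) ≠ 0 := by positivity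
    rw [norm_eq, mul_eq_zero, or_iff_right hc, ENNReal.toReal_eq_zero_iff,
      or_iff_left f.memLp.eLpNorm_ne_top, eLpNorm_eq_zero_iff f.memLp.1 h0,
      (Fock.continuous_weighted f.differentiable).ae_eq_iff_eq volume continuous_zero]
    constructor
    · intro h
      ext z
      have := congrFun h z
      simpa [Fock.weighted] using this
    · rintro rfl
      ext z
      simp [Fock.weighted]

instance : NormedAddCommGroup (FockSpace p) := NormedAddCommGroup.ofCore normCore

instance : NormedSpace ℂ (FockSpace p) := NormedSpace.ofCore normCore

end FockSpace

/-- A bounded linear operator `T` is supercyclic if for some vector `x` the projective orbit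
`{c • T ^ n x : c ∈ ℂ, n ∈ ℕ₀}` is dense. -/
def IsSupercyclic {X : Type*} [NormedAddCommGroup X] [NormedSpace ℂ X] (T : X →L[ℂ] X) : Prop :=
  ∃ x : X, Dense {y : X | ∃ (c : ℂ) (n : ℕ), y = c • (T ^ n) x}

/-- The bounded operator `C` on `F_p` is the composition operator `f ↦ f ∘ ψ`. -/
def IsCompositionOperator {p : ℝ} [Fact (1 ≤ p)] (ψ : ℂ → ℂ)
    (C : FockSpace p →L[ℂ] FockSpace p) : Prop :=
  ∀ (f : FockSpace p) (z : ℂ), C f z = f (ψ z)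

/-- The bounded operator `M` on `F_p` is the multiplication operator `f ↦ u · f`. -/
def IsMultiplicationOperator {p : ℝ} [Fact (1 ≤ p)] (u : ℂ → ℂ)
    (M : FockSpace p →L[ℂ] FockSpace p) : Prop :=
  ∀ (f : FockSpace p) (z : ℂ), M f z = u z * f z

end

/-! Each operator has a point `z` at which it multiplies values by some `a` and derivatives by some
`b` with `‖b‖ ≤ ‖a‖`. Along the projective orbit of `x` this forces `‖y'(z)‖ ‖x(z)‖ ≤ ‖x'(z)‖
‖y(z)‖`. Both evaluations are continuous, so density would extend the inequality to every `y`, and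
some `y` has value 0 and derivative 1 at `z`; if `x(z) = 0`, the whole orbit vanishes at `z` instead
(`FockSpace.not_isSupercyclic`). The point comes from testing boundedness on normalized kernels,
which all have the same norm and are extremal, up to a constant, for point evaluation. A multiplier
is thus bounded, hence constant by Liouville. A composition symbol satisfies `‖ψ z‖² ≤ ‖z‖² + B`,
hence is affine with slope of modulus at most 1 and is not a nonzero translation, so it has a fixed
point. -/

noncomputable section

/-! ### Point evaluation bounds from the sub-mean value property -/

namespace Fock

/-- The sub-mean value property of an entire function over circles centred at the origin. -/
lemma two_pi_mul_enorm_zero_le {g : ℂ → ℂ} (hg : Differentiable ℂ g) (w : ℂ) :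
    ENNReal.ofReal (2 * Real.pi) * ‖g 0‖ₑ ≤
      ∫⁻ θ in Set.Ioc 0 (2 * Real.pi), ‖g (circleMap 0 1 θ * w)‖ₑ := by
  have hpi : 0 < 2 * Real.pi := by positivity
  have hd : Differentiable ℂ fun z => g (z * w) := by fun_prop
  have h := (hd.diffContOnCl (s := Metric.ball 0 |1|)).circleAverage
  rw [Real.circleAverage_def, intervalIntegral.integral_of_le hpi.le] at h
  have h2 : (2 * Real.pi) • g 0 =
      ∫ θ in Set.Ioc 0 (2 * Real.pi), g (circleMap 0 1 θ * w) := by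
    rw [zero_mul] at h
    rw [← h, smul_smul, mul_inv_cancel₀ hpi.ne', one_smul]
  calc ENNReal.ofReal (2 * Real.pi) * ‖g 0‖ₑ = ‖(2 * Real.pi) • g 0‖ₑ := by
        rw [enorm_smul, Real.enorm_of_nonneg hpi.le]
    _ ≤ _ := by
        rw [h2]
        exact enorm_integral_le_lintegral_enorm _

/-- The area sub-mean value property of an entire function on the unit disc. -/
lemma volume_ball_mul_enorm_zero_le {g : ℂ → ℂ} (hg : Differentiable ℂ g) :
    volume (Metric.ball (0 : ℂ) 1) * ‖g 0‖ₑ ≤ ∫⁻ w in Metric.ball (0 : ℂ) 1, ‖g w‖ₑ := by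
  have hpi : 0 < 2 * Real.pi := by positivity
  have hgc := hg.continuous
  have hrot (θ : ℝ) : ∫⁻ w in Metric.ball (0 : ℂ) 1, ‖g (circleMap 0 1 θ * w)‖ₑ =
      ∫⁻ w in Metric.ball (0 : ℂ) 1, ‖g w‖ₑ := by
    let e : ℂ ≃ₗᵢ[ℝ] ℂ := rotation (Circle.exp θ)
    have he (w : ℂ) : circleMap 0 1 θ * w = e w := by
      simp [e, circleMap, Circle.coe_exp]
    have := e.measurePreserving.setLIntegral_comp_preimage
      (Metric.isOpen_ball (x := (0 : ℂ)) (ε := 1)).measurableSet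
      (f := fun w => ‖g w‖ₑ) (by fun_prop)
    rw [LinearIsometryEquiv.preimage_ball, map_zero] at this
    simpa only [he] using this
  have key : ENNReal.ofReal (2 * Real.pi) * (volume (Metric.ball (0 : ℂ) 1) * ‖g 0‖ₑ) ≤
      ENNReal.ofReal (2 * Real.pi) * ∫⁻ w in Metric.ball (0 : ℂ) 1, ‖g w‖ₑ := by
    calc ENNReal.ofReal (2 * Real.pi) * (volume (Metric.ball (0 : ℂ) 1) * ‖g 0‖ₑ)
        = ∫⁻ _ in Metric.ball (0 : ℂ) 1, ENNReal.ofReal (2 * Real.pi) * ‖g 0‖ₑ := by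
          rw [setLIntegral_const]; ring
      _ ≤ ∫⁻ w in Metric.ball (0 : ℂ) 1,
            ∫⁻ θ in Set.Ioc 0 (2 * Real.pi), ‖g (circleMap 0 1 θ * w)‖ₑ :=
          lintegral_mono fun w => two_pi_mul_enorm_zero_le hg w
      _ = ∫⁻ θ in Set.Ioc 0 (2 * Real.pi),
            ∫⁻ w in Metric.ball (0 : ℂ) 1, ‖g (circleMap 0 1 θ * w)‖ₑ := by
          refine lintegral_lintegral_swap (Continuous.aemeasurable ?_)
          unfold circleMap Function.uncurry
          fun_prop
      _ = _ := by
          simp only [hrot]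
          rw [setLIntegral_const, Real.volume_Ioc, sub_zero, mul_comm]
  exact (ENNReal.mul_le_mul_iff_right (by simpa using hpi) ENNReal.ofReal_ne_top).1 key

lemma norm_weighted (f : ℂ → ℂ) (z : ℂ) :
    ‖weighted f z‖ = ‖f z‖ * Real.exp (-(‖z‖ ^ 2 / 2)) := by
  rw [weighted, norm_mul, Complex.norm_real, Real.norm_of_nonneg (Real.exp_pos _).le]

/-- The Weyl translate of `f` by `z`. -/
def translate (f : ℂ → ℂ) (z w : ℂ) : ℂ :=
  f (w + z) * Complex.exp (-(starRingEnd ℂ z * w) - (‖z‖ ^ 2 / 2 : ℝ))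

lemma norm_add_sq_complex (w z : ℂ) :
    ‖w + z‖ ^ 2 = ‖w‖ ^ 2 + ‖z‖ ^ 2 + 2 * (starRingEnd ℂ z * w).re := by
  rw [Complex.sq_norm, Complex.sq_norm, Complex.sq_norm, Complex.normSq_add, mul_comm w]

/-- The cross term of `‖w + z‖²` is the real part of a function holomorphic in `w`, so an entire
factor can absorb it. This moves estimates at `z` to the origin. -/
lemma norm_translate (f : ℂ → ℂ) (z w : ℂ) :
    ‖translate f z w‖ = ‖weighted f (w + z)‖ * Real.exp (‖w‖ ^ 2 / 2) := by
  rw [norm_weighted, translate, norm_mul, Complex.norm_exp, mul_assoc, ← Real.exp_add,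
    norm_add_sq_complex, Complex.sub_re, Complex.neg_re, Complex.ofReal_re]
  congr 2
  ring

lemma differentiable_translate {f : ℂ → ℂ} (hf : Differentiable ℂ f) (z : ℂ) :
    Differentiable ℂ (translate f z) := by
  unfold translate
  fun_prop

/-- Point evaluations of `weighted f` are bounded by the `L^p` norm of `weighted f`, uniformly
in the point. -/
lemma exists_enorm_weighted_le {p : ℝ} (hp : 1 ≤ p) :
    ∃ K : ENNReal, K ≠ ⊤ ∧ ∀ f : ℂ → ℂ, Differentiable ℂ f → ∀ z,
      ‖weighted f z‖ₑ ≤ K * eLpNorm (weighted f) (ENNReal.ofReal p) volume := by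
  set V := volume (Metric.ball (0 : ℂ) 1) with hV
  have hV0 : V ≠ 0 := (Metric.measure_ball_pos volume (0 : ℂ) one_pos).ne'
  have hVt : V ≠ ⊤ := measure_ball_lt_top.ne
  have hp' : (1 : ENNReal) ≤ ENNReal.ofReal p := by simpa using hp
  have hexp : 0 ≤ 1 - 1 / p := by
    rw [sub_nonneg, div_le_one (by linarith)]; exact hp
  -- `V⁻¹` comes from the area mean, `exp (1 / 2)` bounds `exp (‖w‖² / 2)` on the unit disc, and `V
  -- ^ (1 - 1 / p)` is the Hölder factor between `L^1` and `L^p`.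
  refine ⟨V⁻¹ * (ENNReal.ofReal (Real.exp (1 / 2)) * V ^ (1 - 1 / p)), ?_, fun f hf z => ?_⟩
  · exact ENNReal.mul_ne_top (ENNReal.inv_ne_top.2 hV0) (ENNReal.mul_ne_top ENNReal.ofReal_ne_top
      (ENNReal.rpow_ne_top_of_nonneg hexp hVt))
  have hc := continuous_weighted hf
  have h0 : ‖weighted f z‖ₑ = ‖translate f z 0‖ₑ := by
    rw [← ofReal_norm, ← ofReal_norm, norm_translate]; simp
  have hcz : Continuous fun w => weighted f (w + z) := by fun_prop
  rw [mul_assoc, ← ENNReal.mul_le_iff_le_inv hV0 hVt, h0]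
  calc V * ‖translate f z 0‖ₑ ≤ ∫⁻ w in Metric.ball (0 : ℂ) 1, ‖translate f z w‖ₑ :=
        volume_ball_mul_enorm_zero_le (differentiable_translate hf z)
    _ ≤ ∫⁻ w in Metric.ball (0 : ℂ) 1,
          ENNReal.ofReal (Real.exp (1 / 2)) * ‖weighted f (w + z)‖ₑ := by
        refine setLIntegral_mono (hcz.enorm.measurable.const_mul _) fun w hw => ?_
        rw [← ofReal_norm, ← ofReal_norm, ← ENNReal.ofReal_mul (Real.exp_pos _).le, norm_translate,
          mul_comm]
        have : ‖w‖ < 1 := by simpa using hw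
        gcongr
        nlinarith [norm_nonneg w]
    _ = ENNReal.ofReal (Real.exp (1 / 2)) *
          eLpNorm (fun w => weighted f (w + z)) 1 (volume.restrict (Metric.ball (0 : ℂ) 1)) := by
        rw [lintegral_const_mul _ hcz.enorm.measurable, eLpNorm_one_eq_lintegral_enorm]
    _ ≤ ENNReal.ofReal (Real.exp (1 / 2)) *
          (eLpNorm (weighted f) (ENNReal.ofReal p) volume * V ^ (1 - 1 / p)) := by
        gcongr
        refine (eLpNorm_le_eLpNorm_mul_rpow_measure_univ hp' hcz.aestronglyMeasurable).trans ?_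
        rw [Measure.restrict_apply_univ, ENNReal.toReal_one,
          ENNReal.toReal_ofReal (by linarith), one_div_one]
        gcongr
        refine (eLpNorm_mono_measure _ Measure.restrict_le_self).trans_eq ?_
        exact eLpNorm_comp_measurePreserving (g := weighted f) hc.aestronglyMeasurable
          (measurePreserving_add_right volume z)
    _ = _ := by ring

end Fock

/-! ### Continuity of evaluation and of the derivative at a point -/

namespace FockSpace

variable {p : ℝ} [hp : Fact (1 ≤ p)]

lemma exists_norm_apply_le : ∃ K : ℝ, 0 < K ∧ ∀ (f : FockSpace p) (z : ℂ),
    ‖f z‖ ≤ K * ‖f‖ * Real.exp (‖z‖ ^ 2 / 2) := by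
  have h1 : 1 ≤ p := hp.out
  obtain ⟨K, hK, hb⟩ := Fock.exists_enorm_weighted_le h1
  have hc : 0 < (p / (2 * Real.pi)) ^ (1 / p) := by positivity
  refine ⟨K.toReal / (p / (2 * Real.pi)) ^ (1 / p) + 1, by positivity, fun f z => ?_⟩
  have h := ENNReal.toReal_mono (ENNReal.mul_ne_top hK f.memLp.eLpNorm_ne_top)
    (hb f f.differentiable z)
  rw [ENNReal.toReal_mul, toReal_enorm, Fock.norm_weighted, Real.exp_neg,
    ← div_eq_mul_inv, div_le_iff₀ (Real.exp_pos _)] at h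
  refine h.trans (mul_le_mul_of_nonneg_right ?_ (Real.exp_pos _).le)
  calc K.toReal * (eLpNorm (Fock.weighted f) (ENNReal.ofReal p) volume).toReal
      = K.toReal / (p / (2 * Real.pi)) ^ (1 / p) * ‖f‖ := by
        rw [norm_eq, ← mul_assoc, div_mul_cancel₀ _ hc.ne']
    _ ≤ _ := by
        gcongr
        exact le_add_of_nonneg_right zero_le_one

/-- Evaluation at a point, as a continuous functional. -/
def evalCLM (z : ℂ) : FockSpace p →L[ℂ] ℂ :=
  LinearMap.mkContinuousOfExistsBound
    { toFun := fun f => f z, map_add' := fun _ _ => rfl, map_smul' := fun _ _ => rfl } (by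
      obtain ⟨K, -, hK⟩ := exists_norm_apply_le (p := p)
      refine ⟨K * Real.exp (‖z‖ ^ 2 / 2), fun f => (hK f z).trans_eq ?_⟩
      ring)

@[simp] lemma evalCLM_apply (z : ℂ) (f : FockSpace p) : evalCLM z f = f z := rfl

/-- Evaluation of the derivative at a point, as a continuous functional. -/
def derivCLM (z : ℂ) : FockSpace p →L[ℂ] ℂ :=
  LinearMap.mkContinuousOfExistsBound
    { toFun := fun f => deriv f z
      map_add' := fun f g => deriv_add (f.differentiable z) (g.differentiable z)
      map_smul' := fun c f => deriv_const_mul c (f.differentiable z) } (by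
      obtain ⟨K, hK0, hK⟩ := exists_norm_apply_le (p := p)
      refine ⟨K * Real.exp ((‖z‖ + 1) ^ 2 / 2), fun f => ?_⟩
      -- Cauchy's estimate on the unit circle about `z`, where `‖w‖ ≤ ‖z‖ + 1`.
      have := Complex.norm_deriv_le_of_forall_mem_sphere_norm_le (c := z) (R := 1) (f := f)
        (C := K * ‖f‖ * Real.exp ((‖z‖ + 1) ^ 2 / 2)) one_pos f.differentiable.diffContOnCl
        (fun w hw => (hK f w).trans ?_)
      · rw [div_one] at this
        refine this.trans_eq ?_
        ring
      · have hw' : ‖w‖ ≤ ‖z‖ + 1 := by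
          have h2 : ‖w - z‖ = 1 := by simpa using hw
          linarith [norm_le_norm_add_norm_sub' w z]
        gcongr)

@[simp] lemma derivCLM_apply (z : ℂ) (f : FockSpace p) : derivCLM z f = deriv f z := rfl

end FockSpace

/-! ### Normalized kernels -/

namespace Fock

/-- The normalized reproducing kernel at `w`. -/
def kernel (w z : ℂ) : ℂ := Complex.exp (starRingEnd ℂ w * z - (‖w‖ ^ 2 / 2 : ℝ))

lemma differentiable_kernel (w : ℂ) : Differentiable ℂ (kernel w) := by
  unfold kernel
  fun_prop

lemma norm_kernel (w z : ℂ) :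
    ‖kernel w z‖ = Real.exp (‖z‖ ^ 2 / 2) * Real.exp (-(‖z - w‖ ^ 2 / 2)) := by
  have h := norm_add_sq_complex z (-w)
  rw [norm_neg, map_neg, neg_mul, Complex.neg_re, ← sub_eq_add_neg] at h
  rw [kernel, Complex.norm_exp, ← Real.exp_add, h, Complex.sub_re, Complex.ofReal_re]
  congr 1
  ring

lemma integrand_kernel (p : ℝ) (w z : ℂ) :
    integrand p (kernel w) z = Real.exp (-(p / 2) * ‖z - w‖ ^ 2) := by
  rw [← norm_weighted_rpow, norm_weighted, norm_kernel, ← Real.exp_add, ← Real.exp_add,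
    ← Real.exp_mul]
  congr 1
  ring

lemma integrable_exp_neg_mul_norm_sq {b : ℝ} (hb : 0 < b) :
    Integrable fun z : ℂ => Real.exp (-b * ‖z‖ ^ 2) := by
  have := (GaussianFourier.integrable_cexp_neg_mul_sq_norm_add (V := ℂ) (b := (b : ℂ))
    (by simpa using hb) 0 0).norm
  refine this.congr (Filter.Eventually.of_forall fun z => ?_)
  simp [Complex.norm_exp, ← Complex.ofReal_pow]

end Fock

namespace FockSpace

variable {p : ℝ} [hp : Fact (1 ≤ p)]

/-- The normalized reproducing kernel as an element of the Fock space. -/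
def kernel (w : ℂ) : FockSpace p :=
  ⟨Fock.kernel w, Fock.differentiable_kernel w, by
    have h1 : 1 ≤ p := hp.out
    exact ((Fock.integrable_exp_neg_mul_norm_sq (b := p / 2) (by linarith)).comp_sub_right w).congr
      (Filter.Eventually.of_forall fun z => (Fock.integrand_kernel p w z).symm)⟩

lemma kernel_apply (w z : ℂ) : (kernel w : FockSpace p) z = Fock.kernel w z := rfl

/-- The weighted modulus is a Gaussian centred at `w`, and area measure is translation invariant. -/
lemma norm_kernel (w : ℂ) : ‖(kernel w : FockSpace p)‖ = ‖(kernel 0 : FockSpace p)‖ := by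
  have h (w : ℂ) : ‖(kernel w : FockSpace p)‖ =
      (p / (2 * Real.pi) * ∫ z : ℂ, Real.exp (-(p / 2) * ‖z - w‖ ^ 2)) ^ (1 / p) := by
    rw [norm_def]
    congr 3 with z
    exact Fock.integrand_kernel p w z
  rw [h, h, integral_sub_right_eq_self (fun z : ℂ => Real.exp (-(p / 2) * ‖z‖ ^ 2))]
  simp

/-- Value and derivative at a point can be prescribed in the Fock space. -/
lemma exists_apply_eq_deriv_eq (z a b : ℂ) : ∃ f : FockSpace p, f z = a ∧ deriv f z = b := by
  have h0 : ((kernel 0 : FockSpace p) : ℂ → ℂ) = fun _ => 1 := by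
    ext w; simp [kernel_apply, Fock.kernel]
  have hd : HasDerivAt (kernel 1 : FockSpace p) ((kernel 1 : FockSpace p) z) z := by
    have : HasDerivAt (fun y : ℂ => Complex.exp (y - (1 / 2 : ℝ))) _ z :=
      ((hasDerivAt_id z).sub_const _).cexp
    convert! this using 1
    · ext y; simp [kernel_apply, Fock.kernel]
    · simp [kernel_apply, Fock.kernel]
  have hne : (kernel 1 : FockSpace p) z ≠ 0 := Complex.exp_ne_zero _
  -- `kernel 0` is the constant 1 and `kernel 1`, a multiple of `exp`, is its own derivative.
  refine ⟨(a - b) • kernel 0 + (b / (kernel 1 : FockSpace p) z) • kernel 1, ?_, ?_⟩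
  · rw [add_apply, smul_apply, smul_apply, h0]
    field_simp
    ring
  · rw [← derivCLM_apply, map_add, map_smul, map_smul, derivCLM_apply, derivCLM_apply, h0,
      hd.deriv]
    simp [hne]

/-! ### Obstruction to supercyclicity -/

/-- An operator that multiplies the value at `z` by `a` and the derivative at `z` by `b`, where
`‖b‖ ≤ ‖a‖`, is not supercyclic. -/
lemma not_isSupercyclic {T : FockSpace p →L[ℂ] FockSpace p} {z a b : ℂ} (hab : ‖b‖ ≤ ‖a‖)
    (ha : ∀ f, T f z = a * f z) (hb : ∀ f, deriv (T f) z = b * deriv f z) :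
    ¬ IsSupercyclic T := by
  rintro ⟨x, hx⟩
  have han (n : ℕ) : (T ^ n) x z = a ^ n * x z := by
    induction n with
    | zero => simp
    | succ n ih => rw [pow_succ', mul_apply_eq_comp, ha, ih]; ring
  have hbn (n : ℕ) : deriv ((T ^ n) x) z = b ^ n * deriv x z := by
    induction n with
    | zero => simp
    | succ n ih => rw [pow_succ', mul_apply_eq_comp, hb, ih]; ring
  have hval : ∀ y : FockSpace p, x z = 0 → y z = 0 := fun y h0 => by
    have : IsClosed {y : FockSpace p | evalCLM z y = 0} :=
      isClosed_eq (evalCLM z).continuous continuous_const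
    refine this.closure_subset_iff.2 ?_ (hx y)
    rintro _ ⟨c, n, rfl⟩
    rw [Set.mem_ofPred_eq, map_smul, evalCLM_apply, han, h0, mul_zero, smul_zero]
  have hder : ∀ y : FockSpace p, ‖deriv y z‖ * ‖x z‖ ≤ ‖deriv x z‖ * ‖y z‖ := fun y => by
    have : IsClosed {y : FockSpace p |
        ‖derivCLM z y‖ * ‖x z‖ ≤ ‖deriv x z‖ * ‖evalCLM z y‖} :=
      isClosed_le (by fun_prop) (by fun_prop)
    refine this.closure_subset_iff.2 ?_ (hx y)
    rintro _ ⟨c, n, rfl⟩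
    rw [Set.mem_ofPred_eq, map_smul, map_smul, derivCLM_apply, evalCLM_apply, han, hbn]
    simp only [smul_eq_mul, norm_mul, norm_pow]
    calc ‖c‖ * (‖b‖ ^ n * ‖deriv x z‖) * ‖x z‖ ≤ ‖c‖ * (‖a‖ ^ n * ‖deriv x z‖) * ‖x z‖ := by gcongr
      _ = _ := by ring
  by_cases h0 : x z = 0
  · obtain ⟨y, hy, -⟩ := exists_apply_eq_deriv_eq (p := p) z 1 0
    exact one_ne_zero (hy.symm.trans (hval y h0))
  · obtain ⟨y, hy, hy'⟩ := exists_apply_eq_deriv_eq (p := p) z 0 1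
    have := hder y
    rw [hy, hy'] at this
    simp at this
    exact h0 this

/-! ### Symbols of bounded operators -/

/-- The symbol of a bounded multiplication operator is constant. -/
lemma exists_eq_const_of_isMultiplicationOperator {u : ℂ → ℂ} (hu : Differentiable ℂ u)
    {M : FockSpace p →L[ℂ] FockSpace p} (hM : IsMultiplicationOperator u M) :
    ∃ c, ∀ z, u z = c := by
  obtain ⟨K, hK0, hK⟩ := exists_norm_apply_le (p := p)
  refine ⟨u 0, fun z => hu.apply_eq_apply_of_bounded ?_ z 0⟩
  refine isBounded_iff_forall_norm_le.2 ⟨K * (‖M‖ * ‖(kernel 0 : FockSpace p)‖), ?_⟩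
  rintro _ ⟨w, rfl⟩
  have h1 := hK (M (kernel w)) w
  rw [hM, kernel_apply, norm_mul, Fock.norm_kernel, sub_self] at h1
  have h2 := M.le_opNorm (kernel w)
  rw [norm_kernel] at h2
  have h3 : ‖u w‖ * Real.exp (‖w‖ ^ 2 / 2) ≤
      K * (‖M‖ * ‖(kernel 0 : FockSpace p)‖) * Real.exp (‖w‖ ^ 2 / 2) := by
    refine le_trans (by simpa using h1) ?_
    gcongr
  exact le_of_mul_le_mul_right h3 (Real.exp_pos _)

/-- Evaluating `C (kernel (ψ z))` at `z` gives `exp (‖ψ z‖² / 2) ≤ A exp (‖z‖² / 2)`; then `A ≤ exp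
A` makes `B = 2 * A` work. -/
lemma exists_norm_sq_le_of_isCompositionOperator {ψ : ℂ → ℂ}
    {C : FockSpace p →L[ℂ] FockSpace p} (hC : IsCompositionOperator ψ C) :
    ∃ B : ℝ, 0 ≤ B ∧ ∀ z, ‖ψ z‖ ^ 2 ≤ ‖z‖ ^ 2 + B := by
  obtain ⟨K, hK0, hK⟩ := exists_norm_apply_le (p := p)
  set A := K * (‖C‖ * ‖(kernel 0 : FockSpace p)‖) with hA
  have hA0 : 0 ≤ A := by positivity
  refine ⟨2 * A, by positivity, fun z => ?_⟩
  have h1 := hK (C (kernel (ψ z))) z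
  rw [hC, kernel_apply, Fock.norm_kernel, sub_self] at h1
  have h2 := C.le_opNorm (kernel (ψ z))
  rw [norm_kernel] at h2
  have h3 : Real.exp (‖ψ z‖ ^ 2 / 2) ≤ Real.exp (A + ‖z‖ ^ 2 / 2) := by
    calc Real.exp (‖ψ z‖ ^ 2 / 2) ≤ A * Real.exp (‖z‖ ^ 2 / 2) := by
          refine le_trans (by simpa using h1) ?_
          rw [hA]
          gcongr
      _ ≤ Real.exp A * Real.exp (‖z‖ ^ 2 / 2) := by
          gcongr
          linarith [Real.add_one_le_exp A]
      _ = _ := (Real.exp_add _ _).symm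
  linarith [Real.exp_le_exp.1 h3]

end FockSpace

/-- An entire function `ψ` with `‖ψ z‖² ≤ ‖z‖² + B` is an affine contraction with a fixed
point. -/
lemma exists_fixedPoint_of_norm_sq_le {ψ : ℂ → ℂ} (hψ : Differentiable ℂ ψ) {B : ℝ} (hB : 0 ≤ B)
    (h : ∀ z, ‖ψ z‖ ^ 2 ≤ ‖z‖ ^ 2 + B) :
    ∃ a z₀ : ℂ, ‖a‖ ≤ 1 ∧ ψ z₀ = z₀ ∧ HasDerivAt ψ a z₀ := by
  have hlin (z : ℂ) : ‖ψ z‖ ≤ ‖z‖ + (B + 1) := by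
    refine abs_le_of_sq_le_sq' ?_ (by positivity) |>.2
    nlinarith [h z, norm_nonneg z]
  -- The difference quotient at 0 is entire and, by linear growth of `ψ`, bounded; Liouville makes
  -- it constant, so `ψ` is affine.
  have hdiff : Differentiable ℂ (dslope ψ 0) := by
    rw [← differentiableOn_univ]
    exact (Complex.differentiableOn_dslope Filter.univ_mem).2 hψ.differentiableOn
  obtain ⟨R, hR⟩ : ∃ R, ∀ z ∈ Metric.closedBall (0 : ℂ) 1, ‖dslope ψ 0 z‖ ≤ R :=
    (isCompact_closedBall 0 1).exists_bound_of_continuousOn hdiff.continuous.continuousOn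
  have hbdd : Bornology.IsBounded (Set.range (dslope ψ 0)) := by
    refine isBounded_iff_forall_norm_le.2 ⟨max R (1 + (B + 1) + ‖ψ 0‖), ?_⟩
    rintro _ ⟨z, rfl⟩
    by_cases hz : ‖z‖ ≤ 1
    · exact (hR z (by simpa using hz)).trans (le_max_left _ _)
    · push Not at hz
      have hz0 : z ≠ 0 := by rintro rfl; simp at hz; linarith
      refine le_trans ?_ (le_max_right _ _)
      rw [dslope_of_ne _ hz0, slope_def_field, sub_zero, norm_div, div_le_iff₀ (by linarith)]
      have h0 : 0 ≤ ‖ψ 0‖ := norm_nonneg _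
      nlinarith [norm_sub_le (ψ z) (ψ 0), hlin z]
  set a := dslope ψ 0 0 with ha
  set b := ψ 0 with hb
  have haff (z : ℂ) : ψ z = a * z + b := by
    have h1 := sub_smul_dslope ψ 0 z
    rw [hdiff.apply_eq_apply_of_bounded hbdd z 0, sub_zero, smul_eq_mul] at h1
    linear_combination -h1
  have hder (z : ℂ) : HasDerivAt ψ a z := by
    have : HasDerivAt (fun z => a * z + b) (a * 1) z := ((hasDerivAt_id z).const_mul a).add_const b
    rw [mul_one] at this
    exact this.congr_of_eventuallyEq (Filter.Eventually.of_forall haff)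
  have ha1 : ‖a‖ ≤ 1 := by
    by_contra! hlt
    -- At a real point `t ≥ 0` linear growth gives `t (‖a‖ - 1) ≤ ‖b‖ + B + 1`; this `t` exceeds
    -- that by one.
    set t : ℝ := (‖b‖ + B + 2) / (‖a‖ - 1) with ht
    have ht0 : 0 ≤ t := by
      have : 0 < ‖a‖ - 1 := by linarith
      positivity
    have htm : t * (‖a‖ - 1) = ‖b‖ + B + 2 := div_mul_cancel₀ _ (by linarith)
    have h1 := hlin t
    rw [haff, Complex.norm_real, Real.norm_of_nonneg ht0] at h1
    have h2 := norm_sub_norm_le (a * t) (-b)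
    rw [sub_neg_eq_add, norm_neg, norm_mul, Complex.norm_real, Real.norm_of_nonneg ht0] at h2
    nlinarith
  by_cases h1 : a = 1
  · have hb0 : b = 0 := by
      by_contra hb0
      have hbp : 0 < ‖b‖ := norm_pos_iff.2 hb0
      -- For `ψ z = z + b`, the bound at `t * b` reads `(2t + 1) ‖b‖² ≤ B`, that is, `2B + ‖b‖² ≤
      -- B`.
      set t : ℝ := B / ‖b‖ ^ 2 with ht
      have htm : t * ‖b‖ ^ 2 = B := div_mul_cancel₀ _ (by positivity)
      have h2 := h (t * b)
      have ht0 : 0 ≤ t := by positivity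
      rw [haff, h1, show (1 : ℂ) * (t * b) + b = ((t + 1 : ℝ) : ℂ) * b by push_cast; ring, norm_mul,
        norm_mul, Complex.norm_real, Complex.norm_real, Real.norm_of_nonneg ht0,
        Real.norm_of_nonneg (by linarith)] at h2
      nlinarith [pow_pos hbp 2]
    exact ⟨a, 0, ha1, hb0, hder 0⟩
  · refine ⟨a, b / (1 - a), ha1, ?_, hder _⟩
    have : 1 - a ≠ 0 := sub_ne_zero.2 (Ne.symm h1)
    rw [haff]
    field_simp
    ring

end

theorem corollary2p2 (p : ℝ) [Fact (1 ≤ p)] :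
    (∀ ψ : ℂ → ℂ, Differentiable ℂ ψ → ∀ C : FockSpace p →L[ℂ] FockSpace p,
      IsCompositionOperator ψ C → ¬ IsSupercyclic C) ∧
    (∀ u : ℂ → ℂ, Differentiable ℂ u → ∀ M : FockSpace p →L[ℂ] FockSpace p,
      IsMultiplicationOperator u M → ¬ IsSupercyclic M) := by
  refine ⟨fun ψ hψ C hC => ?_, fun u hu M hM => ?_⟩
  · obtain ⟨B, hB, hle⟩ := FockSpace.exists_norm_sq_le_of_isCompositionOperator hC
    obtain ⟨a, z, ha, hz, hd⟩ := exists_fixedPoint_of_norm_sq_le hψ hB hle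
    -- At the fixed point values are preserved, and the chain rule multiplies derivatives by the
    -- slope.
    refine FockSpace.not_isSupercyclic (z := z) (a := 1) (b := a) (by simpa using ha)
      (fun f => by rw [hC, hz, one_mul]) fun f => ?_
    have hf : HasDerivAt f (deriv f z) (ψ z) := by
      rw [hz]; exact (f.differentiable z).hasDerivAt
    rw [show (C f : ℂ → ℂ) = f ∘ ψ from funext (hC f), (hf.comp z hd).deriv, mul_comm]
  · obtain ⟨c, hc⟩ := FockSpace.exists_eq_const_of_isMultiplicationOperator hu hM
    refine FockSpace.not_isSupercyclic (z := 0) (a := c) (b := c) le_rfl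
      (fun f => by rw [hM, hc]) fun f => ?_
    rw [show (M f : ℂ → ℂ) = fun z => c * f z from funext fun z => by rw [hM, hc]]
    exact deriv_const_mul c (f.differentiable 0)
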